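/- Let $r\ge 2$ and $n\ge 0$ be integers. An ordered $r$-matching is an $r$-uniform hypergraph $M$ on a finite, totally ordered vertex set in which every vertex lies in exactly one edge; its size is its number of edges. An $r$-pattern is an ordered $r$-matching of size $2$ on the vertex set $\{1,\dots,2r\}$. Two distinct edges $e,f$ of $M$ form the $r$-pattern $P$ if the ordered hypergraph with vertex set $e\cup f$ and edges $e,f$ is order-isomorphic to $P$. A $P$-clique in $M$ is a set of edges of $M$ every two of which form $P$ (so sets of at most one edge are $P$-cliques). Let $L_P(M)$ be the size of a largest $P$-clique in $M$, let $L(M)=\max_P L_P(M)$, the maximum being over all $r$-patterns $P$, and let $L_r(n)$ be the minimum of $L(M)$ over all ordered $r$-matchings $M$ of size $n$. Then \[ \frac{1}{r-1}\cdot n^{1/((r+1)2^{r-2})}\;\le\; L_r(n)\;\le\;\left\lceil n^{1/(2^r-1)}\right\rceil . \] -/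

import Mathlib

/-- An ordered `r`-matching on the (linearly ordered) vertex set `V`: a finite set of edges, each
consisting of exactly `r` vertices, such that every vertex lies in exactly one edge.
(Since there are finitely many edges and all of them are finite, `V` is automatically finite.) -/
structure OrderedMatching (r : ℕ) (V : Type*) [LinearOrder V] where
  edges : Finset (Finset V)
  card_edge : ∀ e ∈ edges, e.card = r
  existsUnique_edge : ∀ v : V, ∃! e : Finset V, e ∈ edges ∧ v ∈ e

namespace OrderedMatching

/-- The size of a matching is its number of edges. -/
def size {r : ℕ} {V : Type*} [LinearOrder V] (M : OrderedMatching r V) : ℕ := M.edges.card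

theorem edges_injective (r : ℕ) (V : Type*) [LinearOrder V] :
    Function.Injective (OrderedMatching.edges : OrderedMatching r V → Finset (Finset V)) := by
  rintro ⟨e, _, _⟩ ⟨f, _, _⟩ h
  cases h
  rfl

noncomputable instance (r : ℕ) (V : Type*) [LinearOrder V] [Fintype V] :
    Fintype (OrderedMatching r V) :=
  Fintype.ofInjective _ (edges_injective r V)

end OrderedMatching

/-- An `r`-pattern is an ordered `r`-matching of size `2` on the vertex set `{0, …, 2r - 1}`. -/
def Pattern (r : ℕ) : Type := {P : OrderedMatching r (Fin (2 * r)) // P.size = 2}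

noncomputable instance (r : ℕ) : Fintype (Pattern r) := by
  classical
  unfold Pattern
  infer_instance

/-- The edges `e` and `f` form the pattern `P`: some order-preserving embedding of the vertices of
`P` maps the two edges of `P` to `e` and `f` (in some order). As the edges of `P` cover its vertex
set, the image of the embedding is `e ∪ f`, so this says that the ordered hypergraph with vertex
set `e ∪ f` and edges `e`, `f` is order-isomorphic to `P`. -/
def FormsPattern {r : ℕ} {V : Type*} [LinearOrder V] (P : Pattern r) (e f : Finset V) : Prop :=
  ∃ φ : Fin (2 * r) ↪o V, P.1.edges.image (fun p => p.map φ.toEmbedding) = {e, f}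

/-- A set `S` of edges is a `P`-clique if every two distinct edges in `S` form the pattern `P`. -/
def IsPatternClique {r : ℕ} {V : Type*} [LinearOrder V] (P : Pattern r)
    (S : Finset (Finset V)) : Prop :=
  ∀ e ∈ S, ∀ f ∈ S, e ≠ f → FormsPattern P e f

namespace OrderedMatching

open Classical in
/-- `L_P(M)`: the size of the largest `P`-clique in `M`. -/
noncomputable def patternCliqueNumber {r : ℕ} {V : Type*} [LinearOrder V]
    (M : OrderedMatching r V) (P : Pattern r) : ℕ :=
  {S ∈ M.edges.powerset | IsPatternClique P S}.sup Finset.card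

/-- `L(M)`: the maximum of `L_P(M)` over all `r`-patterns `P`. -/
noncomputable def cliqueNumber {r : ℕ} {V : Type*} [LinearOrder V]
    (M : OrderedMatching r V) : ℕ :=
  (Finset.univ : Finset (Pattern r)).sup M.patternCliqueNumber

end OrderedMatching

/-- `L_r(n)`: the minimum of `L(M)` over all ordered `r`-matchings `M` of size `n`, on any linearly
ordered vertex set. -/
noncomputable def ramseyParameter (r n : ℕ) : ℕ :=
  sInf {k : ℕ | ∃ (V : Type) (_ : LinearOrder V) (M : OrderedMatching r V),
    M.size = n ∧ M.cliqueNumber = k}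

/-- For `r ≥ 1` there is an ordered `r`-matching of every size, so the infimum defining
`ramseyParameter` is a minimum over a nonempty set. -/
theorem exists_cliqueNumber_eq_ramseyParameter (r n : ℕ) (hr : 1 ≤ r) :
    ∃ (V : Type) (_ : LinearOrder V) (M : OrderedMatching r V),
      M.size = n ∧ M.cliqueNumber = ramseyParameter r n := by
  classical
  have key : ∃ (V : Type) (_ : LinearOrder V) (M : OrderedMatching r V), M.size = n := by
    let g : Fin n → Finset (Fin n ×ₗ Fin r) := fun i => Finset.univ.image fun j => toLex (i, j)
    have hg : ∀ i v, v ∈ g i ↔ (ofLex v).1 = i := by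
      intro i v
      simp only [g, Finset.mem_image, Finset.mem_univ, true_and]
      constructor
      · rintro ⟨j, rfl⟩
        rfl
      · rintro rfl
        exact ⟨(ofLex v).2, rfl⟩
    have hinj : Function.Injective g := by
      intro a b h
      have h1 : toLex (a, (⟨0, hr⟩ : Fin r)) ∈ g a := (hg _ _).2 rfl
      rw [h] at h1
      exact (hg _ _).1 h1
    refine ⟨Fin n ×ₗ Fin r, inferInstance, ⟨Finset.univ.image g, ?_, ?_⟩, ?_⟩
    · intro e he
      obtain ⟨i, -, rfl⟩ := Finset.mem_image.1 he
      rw [Finset.card_image_of_injective, Finset.card_univ, Fintype.card_fin]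
      intro a b h
      exact (Prod.mk.inj (toLex.injective h)).2
    · intro v
      refine ⟨g (ofLex v).1, ⟨Finset.mem_image_of_mem _ (Finset.mem_univ _), (hg _ _).2 rfl⟩, ?_⟩
      rintro e ⟨he, hv⟩
      obtain ⟨i, -, rfl⟩ := Finset.mem_image.1 he
      rw [(hg _ _).1 hv]
    · simp [OrderedMatching.size, Finset.card_image_of_injective _ hinj]
  obtain ⟨V, hV, M, hM⟩ := key
  exact Nat.sInf_mem (s := {k : ℕ | ∃ (V : Type) (_ : LinearOrder V) (M : OrderedMatching r V),
    M.size = n ∧ M.cliqueNumber = k}) ⟨_, V, hV, M, hM, rfl⟩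

/-!
**Lower bound.** Write `r = m + 1` and let `v₀ < ⋯ < v_m` be the vertices of an edge. For two edges
`a`, `b` with `v₀(a) < v₀(b)` record the *signs*, i.e. for which `i` one has `vᵢ(a) < vᵢ(b)`, and the
set `D(a, b)` of *separated gaps*: those `j < m` for which the intervals `[vⱼ, vⱼ₊₁]` of `a` and of
`b` are disjoint. The signs are encoded by the set `T` of those `j` at which the signs of `j` and
`j + 1` agree; `T` contains `D(a, b)`. For fixed `T` the resulting relation `SignedLT` is
transitive, and `D` can only grow along it. Hence "`SignedLT`, with at least `d` separated gaps" is
transitive as well. If no pair has more than `d` separated gaps, then `D` is constant on every chain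
of this relation, and taking every `m`-th element of the chain makes all vertices of a run of
separated gaps of one edge precede those of another; so these elements form a clique for a single
pattern (`lt_iff_of_constant_gaps`). Chains therefore have at most `m * L` elements, and by Mirsky's
theorem (`exists_large_antichain`) passing to an antichain costs a factor `m * L`. Doing so for
`d = |T|, …, 0` and for every `T ⊆ {0, …, m - 1}` leaves at most one edge, and the number of steps
is `∑ (|T| + 1) = (m + 2) * 2 ^ (m - 1) = (r + 1) * 2 ^ (r - 2)`.

**Upper bound.** Let the edges be (some of) the vectors in `{0, …, k - 1} ^ (2 ^ r - 1)`, the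
coordinates being indexed by the numbers `t + 1` with `1 ≤ t + 1 < 2 ^ r`. The `i`-th vertices of
the edges are arranged by a lexicographic key, `lexKey`, such that the relative order of the
vertices of two edges depends only on which of the two is larger at the first coordinate `t` at
which they differ: with `ℓ` the binary logarithm of `t + 1`, the vertices `ℓ, …, r - 1` form a block
in which one edge wholly precedes the other, and the binary digits of `t + 1` say in which order
come the two `i`-th vertices for `i < ℓ`. Conversely the pattern determines `t`
(`eq_of_lexKey_cross_order`). So all pairs in a clique first differ at the same coordinate, and a
clique has at most `k` edges.
-/

/-! ### Large antichains and a sum over subsets -/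

/-- Mirsky's theorem in pigeonhole form: a transitive relation without chains of `K + 1` elements
has an antichain containing at least a `1 / K` fraction of the elements. -/
theorem exists_large_antichain {α : Type*} (R : α → α → Prop)
    (S : Finset α) (K : ℕ)
    (h : ¬ ∃ c : ℕ → α, (∀ i ≤ K, c i ∈ S) ∧ ∀ i j, i < j → j ≤ K → R (c i) (c j))
    (htrans : ∀ a b c, R a b → R b c → R a c) :
    ∃ T ⊆ S, S.card ≤ K * T.card ∧ ∀ a ∈ T, ∀ b ∈ T, ¬ R a b := by
  classical
  -- The label of `a` is the length of the longest chain ending at `a`, counted in steps.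
  let Ends : ℕ → α → Prop := fun k a => ∃ c : ℕ → α, (∀ i ≤ k, c i ∈ S) ∧
    (∀ i j, i < j → j ≤ k → R (c i) (c j)) ∧ c k = a
  let label : α → ℕ := fun a => Nat.findGreatest (fun k => Ends k a) K
  have hK : ∀ a, ¬ Ends K a := fun a ⟨c, h1, h2, _⟩ => h ⟨c, h1, h2⟩
  have hlab : ∀ a ∈ S, Ends (label a) a := by
    intro a ha
    refine Nat.findGreatest_spec (P := fun k => Ends k a) (Nat.zero_le K)
      ⟨fun _ => a, fun _ _ => ha, fun i j hij hj => by omega, rfl⟩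
  have hlt : ∀ a ∈ S, label a < K := by
    intro a ha
    refine lt_of_le_of_ne (Nat.findGreatest_le K) fun he => hK a ?_
    have := hlab a ha
    rwa [he] at this
  have hmono : ∀ a ∈ S, ∀ b ∈ S, R a b → label a < label b := by
    intro a ha b hb hab
    obtain ⟨c, h1, h2, h3⟩ := hlab a ha
    refine Nat.le_findGreatest (P := fun k => Ends k b) (hlt a ha)
      ⟨fun i => if i ≤ label a then c i else b, ?_, ?_, ?_⟩
    · intro i _
      by_cases hi : i ≤ label a
      · simpa [hi] using h1 i hi
      · simpa [hi] using hb
    · intro i j hij hj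
      have hi : i ≤ label a := by omega
      by_cases hj' : j ≤ label a
      · simpa [hi, hj'] using h2 i j hij hj'
      · simp only [hi, hj', if_true, if_false]
        rcases hi.lt_or_eq with hi' | rfl
        · exact htrans _ a _ (h3 ▸ h2 i _ hi' le_rfl) hab
        · rwa [h3]
    · simp
  rcases S.eq_empty_or_nonempty with rfl | ⟨a₀, ha₀⟩
  · exact ⟨∅, by simp⟩
  obtain ⟨y, -, hy⟩ := (Finset.range K).exists_max_image
    (fun y => (S.filter fun a => label a = y).card) ⟨_, Finset.mem_range.2 (hlt a₀ ha₀)⟩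
  refine ⟨S.filter fun a => label a = y, Finset.filter_subset _ _, ?_, ?_⟩
  · rw [Finset.card_eq_sum_card_fiberwise (f := label) (t := Finset.range K)
      fun a ha => by simpa using hlt a ha]
    simpa using Finset.sum_le_card_nsmul _ _ _ hy
  · intro a ha b hb hab
    rw [Finset.mem_filter] at ha hb
    have := hmono a ha.1 b hb.1 hab
    omega

theorem sum_powerset_card_add_one (m : ℕ) (hm : 1 ≤ m) :
    ∑ T ∈ (Finset.range m).powerset, (T.card + 1) = (m + 2) * 2 ^ (m - 1) := by
  have key : ∀ m : ℕ, 2 * ∑ T ∈ (Finset.range m).powerset, (T.card + 1) = (m + 2) * 2 ^ m := by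
    intro m
    induction m with
    | zero => simp
    | succ k ih =>
      have h1 : ∑ T ∈ (Finset.range k).powerset, ((insert k T).card + 1) =
          ∑ T ∈ (Finset.range k).powerset, (T.card + 1) + 2 ^ k := by
        rw [Finset.sum_congr rfl (g := fun T : Finset ℕ => (T.card + 1) + 1)]
        · rw [Finset.sum_add_distrib (g := fun _ => 1)]
          simp
        · intro T hT
          rw [Finset.card_insert_of_notMem]
          exact fun hk => by simpa using Finset.mem_powerset.1 hT hk
      rw [Finset.range_add_one, Finset.sum_powerset_insert (by simp), h1, pow_succ]
      linarith
  obtain ⟨k, rfl⟩ := Nat.exists_eq_add_of_le' hm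
  have := key (k + 1)
  rw [pow_succ] at this
  simp only [Nat.add_sub_cancel]
  linarith

/-! ### Chains of edges with prescribed signs and separated gaps -/

section GapAnalysis

/- Throughout, `w a i` is the `i`-th vertex of the edge `a`, for `i ≤ m`; values of `w a` beyond `m`
play no role. -/
variable {α V : Type*} [LinearOrder V]

/-- `a` starts before `b`, and the members of `T` below `m` are those `j` for which the comparisons
of the `j`-th and of the `(j + 1)`-st vertices of `a` and `b` go the same way. As the comparison of
the `0`-th vertices is prescribed, `T` encodes the directions of all the others. -/
def SignedLT (m : ℕ) (w : α → ℕ → V) (T : Finset ℕ) (a b : α) : Prop :=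
  w a 0 < w b 0 ∧
    ∀ j < m, j ∈ T ↔ (w a j < w b j ↔ w a (j + 1) < w b (j + 1))

/-- The gaps `j < m` for which the intervals from the `j`-th to the `(j + 1)`-st vertex of `a` and
of `b` are disjoint. -/
def separatedGaps (m : ℕ) (w : α → ℕ → V) (a b : α) : Finset ℕ :=
  {j ∈ Finset.range m | w a (j + 1) < w b j ∨ w b (j + 1) < w a j}

theorem SignedLT.lt_iff_lt {m : ℕ} {w : α → ℕ → V} {T : Finset ℕ} {a b c d : α}
    (hab : SignedLT m w T a b) (hcd : SignedLT m w T c d) :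
    ∀ i ≤ m, (w a i < w b i ↔ w c i < w d i) := by
  intro i
  induction i with
  | zero => exact fun _ => ⟨fun _ => hcd.1, fun _ => hab.1⟩
  | succ k ih =>
    intro hk
    have h0 := ih (by omega)
    have h1 := hab.2 k hk
    have h2 := hcd.2 k hk
    tauto

theorem SignedLT.trans {m : ℕ} {w : α → ℕ → V} {T : Finset ℕ} {a b c : α}
    (hab : SignedLT m w T a b) (hbc : SignedLT m w T b c) : SignedLT m w T a c := by
  have key : ∀ i ≤ m, (w a i < w c i ↔ w a i < w b i) := by
    intro i hi
    have h := hab.lt_iff_lt hbc i hi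
    constructor
    · intro hac
      by_contra hn
      exact absurd hac (not_lt.2 ((not_lt.1 (mt h.2 hn)).trans (not_lt.1 hn)))
    · exact fun h1 => h1.trans (h.1 h1)
  refine ⟨hab.1.trans hbc.1, fun j hj => ?_⟩
  rw [key j hj.le, key (j + 1) hj]
  exact hab.2 j hj

/-- Across a separated gap the two comparisons go the same way. -/
theorem separatedGaps_subset {m : ℕ} {w : α → ℕ → V}
    (hw : ∀ a, ∀ i j, i < j → j ≤ m → w a i < w a j) {T : Finset ℕ} {a b : α}
    (hab : SignedLT m w T a b) : separatedGaps m w a b ⊆ T := by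
  intro j hj
  rw [separatedGaps, Finset.mem_filter, Finset.mem_range] at hj
  obtain ⟨hjm, h⟩ := hj
  rw [hab.2 j hjm]
  have ha := hw a j (j + 1) (by omega) hjm
  have hb := hw b j (j + 1) (by omega) hjm
  rcases h with h | h
  · exact ⟨fun _ => h.trans hb, fun _ => ha.trans h⟩
  · exact ⟨fun h' => absurd h' (hb.trans h).not_gt, fun h' => absurd h' (h.trans ha).not_gt⟩

theorem SignedLT.separatedGaps_subset_left {m : ℕ} {w : α → ℕ → V}
    (hw : ∀ a, ∀ i j, i < j → j ≤ m → w a i < w a j) {T : Finset ℕ} {a b c : α}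
    (hab : SignedLT m w T a b) (hbc : SignedLT m w T b c) :
    separatedGaps m w a b ⊆ separatedGaps m w a c := by
  intro j hj
  rw [separatedGaps, Finset.mem_filter, Finset.mem_range] at hj ⊢
  obtain ⟨hjm, h⟩ := hj
  refine ⟨hjm, ?_⟩
  have ha := hw a j (j + 1) (by omega) hjm
  have hb := hw b j (j + 1) (by omega) hjm
  rcases h with h | h
  · exact Or.inl (h.trans ((hab.lt_iff_lt hbc j hjm.le).1 (ha.trans h)))
  · refine Or.inr (lt_of_le_of_lt (not_lt.1 fun h' => ?_) h)
    exact absurd ((hab.lt_iff_lt hbc (j + 1) hjm).2 h') (h.trans ha).not_gt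

theorem SignedLT.separatedGaps_subset_right {m : ℕ} {w : α → ℕ → V}
    (hw : ∀ a, ∀ i j, i < j → j ≤ m → w a i < w a j) {T : Finset ℕ} {a b c : α}
    (hab : SignedLT m w T a b) (hbc : SignedLT m w T b c) :
    separatedGaps m w b c ⊆ separatedGaps m w a c := by
  intro j hj
  rw [separatedGaps, Finset.mem_filter, Finset.mem_range] at hj ⊢
  obtain ⟨hjm, h⟩ := hj
  refine ⟨hjm, ?_⟩
  have hb := hw b j (j + 1) (by omega) hjm
  have hc := hw c j (j + 1) (by omega) hjm
  rcases h with h | h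
  · exact Or.inl (((hab.lt_iff_lt hbc (j + 1) hjm).2 (h.trans hc)).trans h)
  · refine Or.inr (lt_of_lt_of_le h (not_lt.1 fun h' => ?_))
    exact absurd ((hab.lt_iff_lt hbc j hjm.le).1 h') (hc.trans h).not_gt

/-- The vertices of `a` are situated relative to those of `b` as those of `c` are to those of
`d`. -/
def SameCrossOrder (m : ℕ) (w : α → ℕ → V) (a b c d : α) : Prop :=
  ∀ i ≤ m, ∀ j ≤ m, (w a i < w b j ↔ w c i < w d j)

/-- In a chain `c 0, …, c K` with constant set `D` of separated gaps, the order between vertices of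
two members at least `m` steps apart is the same for all such pairs: if a gap between the `p`-th and
the `q`-th vertex is not separated, it puts the smaller index first, and otherwise the order is that
of the two `p`-th vertices. -/
theorem lt_iff_of_constant_gaps {m : ℕ} {w : α → ℕ → V}
    (hw : ∀ a, ∀ i j, i < j → j ≤ m → w a i < w a j)
    (hinj : ∀ a b, ∀ i ≤ m, ∀ j ≤ m, w a i = w b j → a = b)
    {T D : Finset ℕ} {K : ℕ} {c : ℕ → α}
    (hlt : ∀ i j, i < j → j ≤ K → SignedLT m w T (c i) (c j))
    (hD : ∀ i j, i < j → j ≤ K → separatedGaps m w (c i) (c j) = D)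
    {s t : ℕ} (hst : s < t) (hfar : s + m ≤ t) (htK : t ≤ K)
    {p q : ℕ} (hp : p ≤ m) (hq : q ≤ m) :
    w (c s) p < w (c t) q ↔
      ((∃ j ∉ D, min p q ≤ j ∧ j < max p q) ∧ p < q) ∨
      ((¬ ∃ j ∉ D, min p q ≤ j ∧ j < max p q) ∧ w (c 0) p < w (c K) p) := by
  have hne : ∀ {i j : ℕ}, i < j → j ≤ K → c i ≠ c j := by
    intro i j hij hj h
    have := (hlt i j hij hj).1
    rw [h] at this
    exact lt_irrefl _ this
  have hw' : ∀ a, ∀ i j, i ≤ j → j ≤ m → w a i ≤ w a j := by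
    intro a i j hij hj
    rcases hij.lt_or_eq with h | rfl
    · exact (hw a i j h hj).le
    · exact le_rfl
  -- A gap outside `D` is met by all edges of the chain, so it separates the vertices before it
  -- from those after it.
  have hcross : ∀ j ∉ D, j < m →
      w (c s) j < w (c t) (j + 1) ∧ w (c t) j < w (c s) (j + 1) := by
    intro j hjD hjm
    rw [← hD s t hst htK, separatedGaps, Finset.mem_filter, Finset.mem_range] at hjD
    push Not at hjD
    obtain ⟨h1, h2⟩ := hjD hjm
    exact ⟨lt_of_le_of_ne h2 fun h => hne hst htK (hinj _ _ _ hjm.le _ hjm h),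
      lt_of_le_of_ne h1 fun h => hne hst htK (hinj _ _ _ hjm.le _ hjm h).symm⟩
  have hsign : ∀ i ≤ m, ∀ {x y : ℕ}, x < y → y ≤ K →
      (w (c x) i < w (c y) i ↔ w (c 0) i < w (c K) i) := fun i hi x y hxy hy =>
    (hlt x y hxy hy).lt_iff_lt (hlt 0 K (by omega) le_rfl) i hi
  have hDm : ∀ j ∈ D, j < m := by
    intro j hj
    rw [← hD s t hst htK, separatedGaps, Finset.mem_filter, Finset.mem_range] at hj
    exact hj.1
  have hDsign : ∀ j ∈ D, (w (c 0) j < w (c K) j ↔ w (c 0) (j + 1) < w (c K) (j + 1)) := by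
    intro j hj
    refine ((hlt 0 K (by omega) le_rfl).2 j (hDm j hj)).1 ?_
    rw [← hD s t hst htK] at hj
    exact separatedGaps_subset hw (hlt s t hst htK) hj
  have hrun : ∀ k l, (∀ j, k ≤ j → j < k + l → j ∈ D) →
      ((w (c 0) k < w (c K) k ↔ w (c 0) (k + l) < w (c K) (k + l))) := by
    intro k l
    induction l with
    | zero => simp
    | succ l ih =>
      intro h
      rw [ih fun j h1 h2 => h j h1 (by omega)]
      exact hDsign (k + l) (h _ (by omega) (by omega))
  have hpos : ∀ j ∈ D, w (c 0) j < w (c K) j → ∀ x, x + 1 ≤ K →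
      w (c x) (j + 1) < w (c (x + 1)) j := by
    intro j hj hs x hx
    have hjm := hDm j hj
    have h1 := (hsign j hjm.le (Nat.lt_succ_self x) hx).2 hs
    rw [← hD x (x + 1) (Nat.lt_succ_self x) hx, separatedGaps, Finset.mem_filter] at hj
    rcases hj.2 with h | h
    · exact h
    · exact absurd ((hw _ j (j + 1) (by omega) hjm).trans h) h1.not_gt
  have hneg : ∀ j ∈ D, ¬ w (c 0) j < w (c K) j → ∀ x, x + 1 ≤ K →
      w (c (x + 1)) (j + 1) < w (c x) j := by
    intro j hj hs x hx
    have hjm := hDm j hj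
    have h1 := mt (hsign j hjm.le (Nat.lt_succ_self x) hx).1 hs
    rw [← hD x (x + 1) (Nat.lt_succ_self x) hx, separatedGaps, Finset.mem_filter] at hj
    rcases hj.2 with h | h
    · exact absurd ((hw _ j (j + 1) (by omega) hjm).trans h) h1
    · exact h
  -- Along a run of separated gaps, each step of the chain moves past one more vertex.
  have hposrun : ∀ k l, (∀ j, k ≤ j → j < k + l → j ∈ D) → w (c 0) k < w (c K) k →
      ∀ x, x + l ≤ K → w (c x) (k + l) ≤ w (c (x + l)) k := by
    intro k l
    induction l with
    | zero => intros; exact le_rfl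
    | succ l ih =>
      intro h hs x hx
      have h' : ∀ j, k ≤ j → j < k + l → j ∈ D := fun j h1 h2 => h j h1 (by omega)
      have h1 := hpos (k + l) (h _ (by omega) (by omega)) ((hrun k l h').1 hs) x (by omega)
      have h2 := ih h' hs (x + 1) (by omega)
      rw [show x + (l + 1) = x + 1 + l by omega]
      exact h1.le.trans h2
  have hnegrun : ∀ k l, (∀ j, k ≤ j → j < k + l → j ∈ D) → ¬ w (c 0) k < w (c K) k →
      ∀ x, x + l ≤ K → w (c (x + l)) (k + l) ≤ w (c x) k := by
    intro k l
    induction l with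
    | zero => intros; exact le_rfl
    | succ l ih =>
      intro h hs x hx
      have h' : ∀ j, k ≤ j → j < k + l → j ∈ D := fun j h1 h2 => h j h1 (by omega)
      have h1 := hneg (k + l) (h _ (by omega) (by omega)) (mt (hrun k l h').2 hs) (x + l)
        (by omega)
      exact h1.le.trans (ih h' hs x (by omega))
  have hle : ∀ i ≤ m, w (c 0) i < w (c K) i → ∀ x y, x ≤ y → y ≤ K →
      w (c x) i ≤ w (c y) i := by
    intro i hi hs x y hxy hy
    rcases hxy.lt_or_eq with h | rfl
    · exact ((hsign i hi h hy).2 hs).le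
    · exact le_rfl
  have hge : ∀ i ≤ m, ¬ w (c 0) i < w (c K) i → ∀ x y, x ≤ y → y ≤ K →
      w (c y) i ≤ w (c x) i := by
    intro i hi hs x y hxy hy
    rcases hxy.lt_or_eq with h | rfl
    · exact not_lt.1 (mt (hsign i hi h hy).1 hs)
    · exact le_rfl
  by_cases hex : ∃ j ∉ D, min p q ≤ j ∧ j < max p q
  · have hpq : p ≠ q := by
      rintro rfl
      obtain ⟨j, -, h1, h2⟩ := hex
      simp at h1 h2
      omega
    simp only [hex, true_and, not_true_eq_false, false_and, or_false]
    obtain ⟨j, hjD, h1, h2⟩ := hex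
    rcases lt_or_gt_of_ne hpq with h | h
    · rw [min_eq_left h.le] at h1
      rw [max_eq_right h.le] at h2
      obtain ⟨h3, -⟩ := hcross j hjD (by omega)
      exact ⟨fun _ => h, fun _ => (hw' _ p j h1 (by omega)).trans_lt
        (h3.trans_le (hw' _ (j + 1) q h2 hq))⟩
    · rw [min_eq_right h.le] at h1
      rw [max_eq_left h.le] at h2
      obtain ⟨-, h3⟩ := hcross j hjD (by omega)
      refine ⟨fun h' => absurd h' ?_, fun h' => absurd h' h.not_gt⟩
      exact ((hw' _ q j h1 (by omega)).trans_lt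
        (h3.trans_le (hw' _ (j + 1) p h2 hp))).not_gt
  · simp only [hex, false_and, not_false_eq_true, true_and, false_or]
    push Not at hex
    have hall : ∀ j, min p q ≤ j → j < max p q → j ∈ D := by
      intro j h1 h2
      by_contra hj
      exact absurd h2 (not_lt.2 (hex j hj h1))
    have hnlt : w (c s) p ≠ w (c t) q := fun h => hne hst htK (hinj _ _ _ hp _ hq h)
    rcases le_total p q with h | h
    · rw [min_eq_left h, max_eq_right h] at hall
      obtain ⟨l, rfl⟩ := Nat.exists_eq_add_of_le h
      constructor
      · intro h1
        by_contra hs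
        have h2 := hnegrun p l hall hs s (by omega)
        have h3 := hge (p + l) hq (mt (hrun p l hall).2 hs) (s + l) t (by omega) htK
        exact absurd h1 (h3.trans h2).not_gt
      · intro hs
        exact lt_of_le_of_ne ((hle p hp hs s t hst.le htK).trans (hw' _ _ _ h hq)) hnlt
    · rw [min_eq_right h, max_eq_left h] at hall
      obtain ⟨l, rfl⟩ := Nat.exists_eq_add_of_le h
      rw [← hrun q l hall]
      constructor
      · intro h1
        by_contra hs
        exact absurd h1 (((hge q hq hs s t hst.le htK).trans (hw' _ _ _ h hp)).not_gt)
      · intro hs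
        have h2 := hposrun q l hall hs s (by omega)
        have h3 := hle q hq hs (s + l) t (by omega) htK
        exact lt_of_le_of_ne (h2.trans h3) hnlt

/-- The elements comparable through `SignedLT m w T` are removed by passing to antichains, starting
with the pairs which have the largest number of separated gaps. -/
theorem exists_subset_without_signedLT {m : ℕ} (hm : 1 ≤ m) {w : α → ℕ → V}
    (hw : ∀ a, ∀ i j, i < j → j ≤ m → w a i < w a j)
    (hinj : ∀ a b, ∀ i ≤ m, ∀ j ≤ m, w a i = w b j → a = b)
    {L : ℕ} (S : Finset α)
    (hL : ¬ ∃ c : ℕ → α, (∀ i ≤ L, c i ∈ S) ∧ (∀ i j, i < j → j ≤ L → c i ≠ c j) ∧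
      ∀ i j k l, i < j → j ≤ L → k < l → l ≤ L → SameCrossOrder m w (c i) (c j) (c k) (c l))
    (T : Finset ℕ) :
    ∃ S' ⊆ S, S.card ≤ (m * L) ^ (T.card + 1) * S'.card ∧
      ∀ a ∈ S', ∀ b ∈ S', ¬ SignedLT m w T a b := by
  have key : ∀ k : ℕ, ∃ S' ⊆ S, S.card ≤ (m * L) ^ k * S'.card ∧
      ∀ a ∈ S', ∀ b ∈ S', SignedLT m w T a b → (separatedGaps m w a b).card + k ≤ T.card := by
    intro k
    induction k with
    | zero =>
      exact ⟨S, subset_rfl, by simp, fun a _ b _ h =>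
        Finset.card_le_card (separatedGaps_subset hw h)⟩
    | succ k ih =>
      obtain ⟨S₁, hS₁, hc₁, hg₁⟩ := ih
      let R : α → α → Prop :=
        fun a b => SignedLT m w T a b ∧ T.card ≤ (separatedGaps m w a b).card + k
      have htrans : ∀ a b c, R a b → R b c → R a c := by
        rintro a b c ⟨hab, h1⟩ ⟨hbc, -⟩
        refine ⟨hab.trans hbc, h1.trans ?_⟩
        have := Finset.card_le_card (hab.separatedGaps_subset_left hw hbc)
        omega
      have hseq : ¬ ∃ c : ℕ → α, (∀ i ≤ m * L, c i ∈ S₁) ∧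
          ∀ i j, i < j → j ≤ m * L → R (c i) (c j) := by
        rintro ⟨c, hcS, hc⟩
        have hcard : ∀ i j, i < j → j ≤ m * L →
            (separatedGaps m w (c i) (c j)).card + k = T.card := fun i j hij hj =>
          le_antisymm (hg₁ _ (hcS _ (by omega)) _ (hcS _ hj) (hc i j hij hj).1)
            (hc i j hij hj).2
        -- `D` is monotone along the chain and has constant cardinality, so it is constant.
        have hD : ∀ i j, i < j → j ≤ m * L →
            separatedGaps m w (c i) (c j) = separatedGaps m w (c 0) (c (m * L)) := by
          have h1 : ∀ i j l, i < j → j ≤ l → l ≤ m * L →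
              separatedGaps m w (c i) (c j) = separatedGaps m w (c i) (c l) := by
            intro i j l hij hjl hl
            rcases hjl.lt_or_eq with hjl | rfl
            · refine Finset.eq_of_subset_of_card_le ((hc i j hij (by omega)).1.separatedGaps_subset_left
                hw (hc j l hjl hl).1) ?_
              have := hcard i j hij (by omega)
              have := hcard i l (by omega) hl
              omega
            · rfl
          have h2 : ∀ i j l, i ≤ j → j < l → l ≤ m * L →
              separatedGaps m w (c j) (c l) = separatedGaps m w (c i) (c l) := by
            intro i j l hij hjl hl
            rcases hij.lt_or_eq with hij | rfl
            · refine Finset.eq_of_subset_of_card_le ((hc i j hij (by omega)).1.separatedGaps_subset_right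
                hw (hc j l hjl hl).1) ?_
              have := hcard j l hjl (by omega)
              have := hcard i l (by omega) hl
              omega
            · rfl
          intro i j hij hj
          rw [h1 i j _ hij hj le_rfl, h2 0 i _ (Nat.zero_le _) (by omega) le_rfl]
        have hlt : ∀ i j, i < j → j ≤ m * L → SignedLT m w T (c i) (c j) :=
          fun i j hij hj => (hc i j hij hj).1
        -- Every `m`-th element of the chain: consecutive ones are `m` steps apart.
        refine hL ⟨fun i => c (m * i), fun i hi => hS₁ (hcS _ (Nat.mul_le_mul_left m hi)), ?_, ?_⟩
        · intro i j hij hj h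
          have := (hlt (m * i) (m * j) (Nat.mul_lt_mul_of_pos_left hij hm)
            (Nat.mul_le_mul_left m hj)).1
          simp only at h
          rw [h] at this
          exact lt_irrefl _ this
        · intro i j k l hij hj hkl hl p hp q hq
          have hfar : ∀ {x y : ℕ}, x < y → m * x + m ≤ m * y := fun {x y} hxy => by
            have := Nat.mul_le_mul_left m (Nat.succ_le_of_lt hxy)
            rwa [Nat.mul_succ] at this
          have h1 := hfar hij
          have h2 := hfar hkl
          rw [lt_iff_of_constant_gaps hw hinj hlt hD (by omega) h1 (Nat.mul_le_mul_left m hj) hp hq,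
            lt_iff_of_constant_gaps hw hinj hlt hD (by omega) h2 (Nat.mul_le_mul_left m hl) hp hq]
      obtain ⟨S₂, hS₂, hc₂, hg₂⟩ := exists_large_antichain R S₁ (m * L) hseq htrans
      refine ⟨S₂, hS₂.trans hS₁, ?_, ?_⟩
      · calc S.card ≤ (m * L) ^ k * S₁.card := hc₁
          _ ≤ (m * L) ^ k * (m * L * S₂.card) := by gcongr
          _ = _ := by ring
      · intro a ha b hb hab
        have h1 := hg₁ a (hS₂ ha) b (hS₂ hb) hab
        have h2 : ¬ T.card ≤ (separatedGaps m w a b).card + k :=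
          fun h => hg₂ a ha b hb ⟨hab, h⟩
        omega
  obtain ⟨S', h1, h2, h3⟩ := key (T.card + 1)
  refine ⟨S', h1, h2, fun a ha b hb hab => ?_⟩
  have := h3 a ha b hb hab
  omega

theorem card_le_of_no_constant_cross_order {m : ℕ} (hm : 1 ≤ m) {w : α → ℕ → V}
    (hw : ∀ a, ∀ i j, i < j → j ≤ m → w a i < w a j)
    (hinj : ∀ a b, ∀ i ≤ m, ∀ j ≤ m, w a i = w b j → a = b)
    {L : ℕ} (S : Finset α)
    (hL : ¬ ∃ c : ℕ → α, (∀ i ≤ L, c i ∈ S) ∧ (∀ i j, i < j → j ≤ L → c i ≠ c j) ∧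
      ∀ i j k l, i < j → j ≤ L → k < l → l ≤ L → SameCrossOrder m w (c i) (c j) (c k) (c l)) :
    S.card ≤ (m * L) ^ ((m + 2) * 2 ^ (m - 1)) := by
  classical
  have key : ∀ F : Finset (Finset ℕ), ∃ S' ⊆ S,
      S.card ≤ (m * L) ^ (∑ T ∈ F, (T.card + 1)) * S'.card ∧
      ∀ T ∈ F, ∀ a ∈ S', ∀ b ∈ S', ¬ SignedLT m w T a b := by
    intro F
    induction F using Finset.induction_on with
    | empty => exact ⟨S, subset_rfl, by simp, by simp⟩
    | insert T F hT ih =>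
      obtain ⟨S₁, hS₁, hc₁, hg₁⟩ := ih
      obtain ⟨S₂, hS₂, hc₂, hg₂⟩ := exists_subset_without_signedLT hm hw hinj S₁
        (fun ⟨c, h1, h2⟩ => hL ⟨c, fun i hi => hS₁ (h1 i hi), h2⟩) T
      refine ⟨S₂, hS₂.trans hS₁, ?_, ?_⟩
      · rw [Finset.sum_insert hT]
        calc S.card ≤ _ := hc₁
          _ ≤ (m * L) ^ (∑ T ∈ F, (T.card + 1)) * ((m * L) ^ (T.card + 1) * S₂.card) := by gcongr
          _ = _ := by ring
      · intro U hU a ha b hb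
        rcases Finset.mem_insert.1 hU with rfl | hU
        · exact hg₂ a ha b hb
        · exact hg₁ U hU a (hS₂ ha) b (hS₂ hb)
  obtain ⟨S', -, hcard, hS'⟩ := key (Finset.range m).powerset
  rw [sum_powerset_card_add_one m hm] at hcard
  refine hcard.trans ((Nat.mul_le_mul_left _ ?_).trans (mul_one _).le)
  rw [Finset.card_le_one]
  -- Any two distinct elements are comparable for one of the sets `T`.
  have hno : ∀ a ∈ S', ∀ b ∈ S', ¬ w a 0 < w b 0 := by
    intro a ha b hb hab
    refine hS' {j ∈ Finset.range m | w a j < w b j ↔ w a (j + 1) < w b (j + 1)}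
      (by simp) a ha b hb ⟨hab, fun j hj => by simp [hj]⟩
  intro a ha b hb
  exact hinj a b 0 (Nat.zero_le _) 0 (Nat.zero_le _)
    (le_antisymm (not_lt.1 (hno b hb a ha)) (not_lt.1 (hno a ha b hb)))

end GapAnalysis

/-! ### Patterns and relative vertex orders -/

theorem map_orderEmbOfFin_univ {W : Type*} [LinearOrder W] {k : ℕ} (p : Finset W)
    (hp : p.card = k) : Finset.univ.map (p.orderEmbOfFin hp).toEmbedding = p := by
  ext x
  rw [← Finset.mem_coe, Finset.coe_map]
  simp

theorem orderEmbedding_eq_of_map_eq {W W' : Type*} [LinearOrder W] [LinearOrder W'] {k : ℕ}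
    {p : Fin k ↪o W} {φ : W ↪o W'} {v : Fin k ↪o W'}
    (h : (Finset.univ.map p.toEmbedding).map φ.toEmbedding = Finset.univ.map v.toEmbedding)
    (i : Fin k) : φ (p i) = v i := by
  have hcard : (Finset.univ.map v.toEmbedding).card = k := by simp
  have h1 := Finset.orderEmbOfFin_unique' hcard (f := v) (by simp)
  have h2 := Finset.orderEmbOfFin_unique' hcard (f := p.trans φ) (fun x => by
    rw [← h]; simp)
  rw [h1, ← h2]
  rfl

/-- Two pairs of edges that form the same pattern have the same relative order of vertices, up to
exchanging the two edges of one pair. -/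
theorem FormsPattern.lt_iff_lt_or {r : ℕ} {V : Type*} [LinearOrder V] {P : Pattern r}
    {v₁ v₂ w₁ w₂ : Fin r ↪o V}
    (hv : FormsPattern P (Finset.univ.map v₁.toEmbedding) (Finset.univ.map v₂.toEmbedding))
    (hw : FormsPattern P (Finset.univ.map w₁.toEmbedding) (Finset.univ.map w₂.toEmbedding)) :
    (∀ i j, v₁ i < v₂ j ↔ w₁ i < w₂ j) ∨ (∀ i j, v₁ i < v₂ j ↔ w₂ i < w₁ j) := by
  classical
  obtain ⟨p, q, hpq, hPe⟩ := Finset.card_eq_two.1 P.2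
  have hp := P.1.card_edge p (by simp [hPe])
  have hq := P.1.card_edge q (by simp [hPe])
  have key : ∀ {v₁ v₂ : Fin r ↪o V},
      FormsPattern P (Finset.univ.map v₁.toEmbedding) (Finset.univ.map v₂.toEmbedding) →
      ∃ φ : Fin (2 * r) ↪o V,
        (∀ i, φ (p.orderEmbOfFin hp i) = v₁ i) ∧ (∀ i, φ (q.orderEmbOfFin hq i) = v₂ i) ∨
        (∀ i, φ (p.orderEmbOfFin hp i) = v₂ i) ∧ (∀ i, φ (q.orderEmbOfFin hq i) = v₁ i) := by
    rintro v₁ v₂ ⟨φ, hφ⟩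
    rw [hPe, Finset.image_insert, Finset.image_singleton] at hφ
    rw [← map_orderEmbOfFin_univ p hp, ← map_orderEmbOfFin_univ q hq] at hφ
    have hφ' := congrArg (fun s : Finset (Finset V) => (s : Set (Finset V))) hφ
    simp only [Finset.coe_insert, Finset.coe_singleton] at hφ'
    rw [Set.pair_eq_pair_iff] at hφ'
    rcases hφ' with ⟨h1, h2⟩ | ⟨h1, h2⟩
    · exact ⟨φ, Or.inl ⟨orderEmbedding_eq_of_map_eq h1, orderEmbedding_eq_of_map_eq h2⟩⟩
    · exact ⟨φ, Or.inr ⟨orderEmbedding_eq_of_map_eq h1, orderEmbedding_eq_of_map_eq h2⟩⟩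
  obtain ⟨φ, h⟩ := key hv
  obtain ⟨ψ, h'⟩ := key hw
  rcases h with ⟨h1, h2⟩ | ⟨h1, h2⟩ <;> rcases h' with ⟨h3, h4⟩ | ⟨h3, h4⟩
  · left; intro i j
    rw [← h1, ← h2, ← h3, ← h4, φ.lt_iff_lt, ψ.lt_iff_lt]
  · right; intro i j
    rw [← h1, ← h2, ← h3, ← h4, φ.lt_iff_lt, ψ.lt_iff_lt]
  · right; intro i j
    rw [← h1, ← h2, ← h3, ← h4, φ.lt_iff_lt, ψ.lt_iff_lt]
  · left; intro i j
    rw [← h1, ← h2, ← h3, ← h4, φ.lt_iff_lt, ψ.lt_iff_lt]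

theorem FormsPattern.symm {r : ℕ} {V : Type*} [LinearOrder V] {P : Pattern r} {e f : Finset V}
    (h : FormsPattern P e f) : FormsPattern P f e := by
  obtain ⟨φ, hφ⟩ := h
  exact ⟨φ, hφ.trans (Finset.pair_comm e f)⟩

/-- Two disjoint edges form a pattern, and so does every other pair of disjoint edges in the same
relative position, with the same pattern. -/
theorem exists_pattern_of_cross_order {r : ℕ} (hr : 1 ≤ r) {V : Type*} [LinearOrder V]
    (v₁ v₂ : Fin r ↪o V) (hne : ∀ i j, v₁ i ≠ v₂ j) :
    ∃ P : Pattern r, ∀ w₁ w₂ : Fin r ↪o V, (∀ i j, w₁ i ≠ w₂ j) →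
      (∀ i j, v₁ i < v₂ j ↔ w₁ i < w₂ j) →
      FormsPattern P (Finset.univ.map w₁.toEmbedding) (Finset.univ.map w₂.toEmbedding) := by
  classical
  have hinj : Function.Injective (Sum.elim v₁ v₂) :=
    v₁.injective.sumElim v₂.injective hne
  have hcard : (Finset.univ.image (Sum.elim v₁ v₂)).card = 2 * r := by
    rw [Finset.card_image_of_injective _ hinj]
    simp [two_mul]
  let φ := (Finset.univ.image (Sum.elim v₁ v₂)).orderEmbOfFin hcard
  have hex : ∀ x, ∃ s, Sum.elim v₁ v₂ s = φ x := by
    intro x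
    have := Finset.orderEmbOfFin_mem _ hcard x
    simpa only [Finset.mem_image, Finset.mem_univ, true_and] using this
  -- `σ` tells which vertex of which edge is the `x`-th smallest of all `2 * r` vertices.
  choose σ₀ hσ₀ using hex
  have hσinj : Function.Injective σ₀ := fun x y hxy =>
    φ.injective (by rw [← hσ₀ x, ← hσ₀ y, hxy])
  let σ : Fin (2 * r) ≃ Fin r ⊕ Fin r := Equiv.ofBijective σ₀
    ((Fintype.bijective_iff_injective_and_card σ₀).2 ⟨hσinj, by simp [two_mul]⟩)
  have hσ : ∀ x, Sum.elim v₁ v₂ (σ x) = φ x := hσ₀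
  let A : Finset (Fin (2 * r)) := Finset.univ.image fun i : Fin r => σ.symm (Sum.inl i)
  let B : Finset (Fin (2 * r)) := Finset.univ.image fun i : Fin r => σ.symm (Sum.inr i)
  have hA : ∀ x, x ∈ A ↔ (σ x).isLeft := by
    intro x
    simp [A, Equiv.symm_apply_eq, Sum.isLeft_iff, eq_comm (b := σ x)]
  have hB : ∀ x, x ∈ B ↔ (σ x).isRight := by
    intro x
    simp [B, Equiv.symm_apply_eq, Sum.isRight_iff, eq_comm (b := σ x)]
  have hAB : A ≠ B := by
    intro h
    have h1 := (hA (σ.symm (Sum.inl ⟨0, hr⟩))).2 (by simp)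
    rw [h, hB] at h1
    simp at h1
  have hAcard : A.card = r := by
    exact (Finset.card_image_of_injective Finset.univ
      (σ.symm.injective.comp Sum.inl_injective)).trans (Finset.card_fin r)
  have hBcard : B.card = r := by
    exact (Finset.card_image_of_injective Finset.univ
      (σ.symm.injective.comp Sum.inr_injective)).trans (Finset.card_fin r)
  let P : Pattern r := ⟨{
    edges := {A, B}
    card_edge := by
      intro e he
      simp only [Finset.mem_insert, Finset.mem_singleton] at he
      rcases he with rfl | rfl
      · exact hAcard
      · exact hBcard
    existsUnique_edge := by
      intro x
      rcases hx : σ x with i | i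
      · refine ⟨A, ⟨by simp, (hA x).2 (by simp [hx])⟩, ?_⟩
        rintro e ⟨he, hxe⟩
        simp only [Finset.mem_insert, Finset.mem_singleton] at he
        rcases he with rfl | rfl
        · rfl
        · rw [hB, hx] at hxe
          simp at hxe
      · refine ⟨B, ⟨by simp, (hB x).2 (by simp [hx])⟩, ?_⟩
        rintro e ⟨he, hxe⟩
        simp only [Finset.mem_insert, Finset.mem_singleton] at he
        rcases he with rfl | rfl
        · rw [hA, hx] at hxe
          simp at hxe
        · rfl }, Finset.card_pair hAB⟩
  refine ⟨P, fun w₁ w₂ hne' hcross => ?_⟩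
  have hlt : ∀ s t, Sum.elim v₁ v₂ s < Sum.elim v₁ v₂ t → Sum.elim w₁ w₂ s < Sum.elim w₁ w₂ t := by
    rintro (i | i) (j | j) h
    · simpa using h
    · exact (hcross i j).1 h
    · refine lt_of_le_of_ne (not_lt.1 fun h' => ?_) (hne' j i).symm
      exact lt_asymm h ((hcross j i).2 h')
    · simpa using h
  let ψ : Fin (2 * r) ↪o V := OrderEmbedding.ofStrictMono (fun x => Sum.elim w₁ w₂ (σ x))
    fun x y hxy => hlt _ _ (by rw [hσ, hσ]; exact φ.strictMono hxy)
  have hψ : ∀ x, ψ x = Sum.elim w₁ w₂ (σ x) := fun _ => rfl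
  have hψA : A.map ψ.toEmbedding = Finset.univ.map w₁.toEmbedding := by
    ext x
    simp [A, hψ]
  have hψB : B.map ψ.toEmbedding = Finset.univ.map w₂.toEmbedding := by
    ext x
    simp [B, hψ]
  refine ⟨ψ, ?_⟩
  change Finset.image _ ({A, B} : Finset (Finset (Fin (2 * r)))) = _
  rw [Finset.image_insert, Finset.image_singleton, hψA, hψB]

/-! ### The size of a matching in terms of its clique number -/

theorem nonempty_pattern {r : ℕ} (hr : 1 ≤ r) : Nonempty (Pattern r) := by
  let v₁ : Fin r ↪o ℕ := OrderEmbedding.ofStrictMono (fun i => (i : ℕ)) fun _ _ h => h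
  let v₂ : Fin r ↪o ℕ := OrderEmbedding.ofStrictMono (fun i => r + (i : ℕ))
    fun _ _ h => Nat.add_lt_add_left h r
  obtain ⟨P, -⟩ := exists_pattern_of_cross_order hr v₁ v₂ fun i j => by
    change (i : ℕ) ≠ r + (j : ℕ)
    omega
  exact ⟨P⟩

namespace OrderedMatching

theorem card_le_cliqueNumber {r : ℕ} {V : Type*} [LinearOrder V] (M : OrderedMatching r V)
    (P : Pattern r) {S : Finset (Finset V)} (hS : S ⊆ M.edges) (hP : IsPatternClique P S) :
    S.card ≤ M.cliqueNumber := by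
  classical
  have h1 : S.card ≤ M.patternCliqueNumber P := by
    unfold patternCliqueNumber
    exact Finset.le_sup (f := Finset.card)
      (Finset.mem_filter.2 ⟨Finset.mem_powerset.2 hS, hP⟩)
  exact h1.trans (Finset.le_sup (f := M.patternCliqueNumber) (Finset.mem_univ P))

theorem eq_of_mem_of_mem {r : ℕ} {V : Type*} [LinearOrder V] (M : OrderedMatching r V)
    {e f : Finset V} (he : e ∈ M.edges) (hf : f ∈ M.edges) {x : V} (hxe : x ∈ e) (hxf : x ∈ f) :
    e = f :=
  (M.existsUnique_edge x).unique ⟨he, hxe⟩ ⟨hf, hxf⟩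

theorem size_le_pow {m : ℕ} (hm : 1 ≤ m) {V : Type*} [LinearOrder V]
    (M : OrderedMatching (m + 1) V) :
    M.size ≤ (m * M.cliqueNumber) ^ ((m + 2) * 2 ^ (m - 1)) := by
  classical
  let v : M.edges → Fin (m + 1) ↪o V := fun e => e.1.orderEmbOfFin (M.card_edge _ e.2)
  have hvmem : ∀ e i, v e i ∈ e.1 := fun e i => Finset.orderEmbOfFin_mem _ _ i
  have hvmap : ∀ e, Finset.univ.map (v e).toEmbedding = e.1 := fun e => map_orderEmbOfFin_univ _ _
  have hvinj : ∀ a b i j, v a i = v b j → a = b := fun a b i j h =>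
    Subtype.ext (M.eq_of_mem_of_mem a.2 b.2 (hvmem a i) (h ▸ hvmem b j))
  let w : M.edges → ℕ → V := fun e i => v e ⟨min i m, by omega⟩
  have hwv : ∀ e (i : Fin (m + 1)), w e i = v e i := by
    intro e i
    simp only [w]
    congr
    have := i.2
    omega
  have hsize : M.size = (Finset.univ : Finset M.edges).card := by simp [size]
  rw [hsize]
  refine card_le_of_no_constant_cross_order hm (w := w) ?_
    (fun a b i _ j _ h => hvinj a b _ _ h) Finset.univ ?_
  · intro a i j hij hj
    refine (v a).strictMono ?_
    rw [Fin.lt_def]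
    change min i m < min j m
    omega
  · rintro ⟨c, -, hne, hsame⟩
    have hcinj : Set.InjOn (fun i => (c i).1) (Finset.range (M.cliqueNumber + 1)) := by
      intro i hi j hj hij
      simp only [Finset.coe_range, Set.mem_Iio] at hi hj
      rcases lt_trichotomy i j with h | h | h
      · exact absurd (Subtype.ext hij) (hne i j h (by omega))
      · exact h
      · exact absurd (Subtype.ext hij).symm (hne j i h (by omega))
    have hcard := Finset.card_image_of_injOn hcinj
    rw [Finset.card_range] at hcard
    have hP : ∃ P : Pattern (m + 1), ∀ i j, i < j → j ≤ M.cliqueNumber →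
        FormsPattern P (c i).1 (c j).1 := by
      rcases Nat.eq_zero_or_pos M.cliqueNumber with h0 | hpos
      -- A single edge is a clique for every pattern, but some pattern has to exist.
      · obtain ⟨P⟩ := nonempty_pattern (r := m + 1) (by omega)
        exact ⟨P, fun i j hij hj => by omega⟩
      · obtain ⟨P, hP⟩ := exists_pattern_of_cross_order (by omega) (v (c 0)) (v (c 1))
          fun i j h => hne 0 1 one_pos hpos (hvinj _ _ _ _ h)
        refine ⟨P, fun i j hij hj => ?_⟩
        rw [← hvmap, ← hvmap (c j)]
        refine hP _ _ (fun k l h => hne i j hij hj (hvinj _ _ _ _ h)) fun k l => ?_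
        rw [← hwv, ← hwv, ← hwv, ← hwv]
        exact hsame 0 1 i j one_pos hpos hij hj k (by omega) l (by omega)
    obtain ⟨P, hP⟩ := hP
    have := M.card_le_cliqueNumber P
      (S := (Finset.range (M.cliqueNumber + 1)).image fun i => (c i).1)
      (by
        intro e he
        obtain ⟨i, -, rfl⟩ := Finset.mem_image.1 he
        exact (c i).2)
      (by
        intro e he f hf hef
        obtain ⟨i, hi, rfl⟩ := Finset.mem_image.1 he
        obtain ⟨j, hj, rfl⟩ := Finset.mem_image.1 hf
        rw [Finset.mem_range] at hi hj
        rcases lt_trichotomy i j with h | rfl | h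
        · exact hP i j h (by omega)
        · exact absurd rfl hef
        · exact (hP j i h (by omega)).symm)
    omega

end OrderedMatching

/-! ### Lexicographic vertex keys -/

/-- Whether the `i`-th vertices of two edges that first differ at coordinate `t` are ordered like
their values at that coordinate: always for `i ≥ log₂ (t + 1)`, and for smaller `i` if the `i`-th
binary digit of `t + 1` is `1`. -/
def coordSign (t i : ℕ) : Bool := decide (Nat.log 2 (t + 1) ≤ i) || (t + 1).testBit i

/-- The linearly ordered set of vertex keys: sequences of `N` pairs, compared lexicographically
throughout. -/
def KeySpace (N : ℕ) : Type := Lex (Fin N → ℕ ×ₗ ℤ)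

noncomputable instance (N : ℕ) : LinearOrder (KeySpace N) :=
  inferInstanceAs (LinearOrder (Lex (Fin N → ℕ ×ₗ ℤ)))

/-- The entry at coordinate `t` of the key of the `i`-th vertex of the edge `x`: first the index of
the block containing `i`, all `i ≥ log₂ (t + 1)` forming one block, then the signed value of `x`. -/
def keyEntry {N : ℕ} (x : Fin N → ℤ) (i : ℕ) (t : Fin N) : ℕ × ℤ :=
  (min i (Nat.log 2 (t + 1)), if coordSign t i then x t else - x t)

/-- The key of the `i`-th vertex of the edge `x`. -/
def lexKey {N : ℕ} (x : Fin N → ℤ) (i : ℕ) : KeySpace N :=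
  toLex fun t => toLex (keyEntry x i t)

theorem lexKey_lt_of_keyEntry {N : ℕ} {x y : Fin N → ℤ} {i j : ℕ} (t : Fin N)
    (h : ∀ s < t, keyEntry x i s = keyEntry y j s)
    (hlt : (keyEntry x i t).1 < (keyEntry y j t).1 ∨
      (keyEntry x i t).1 = (keyEntry y j t).1 ∧ (keyEntry x i t).2 < (keyEntry y j t).2) :
    lexKey x i < lexKey y j :=
  ⟨t, fun s hs => congrArg toLex (h s hs), Prod.Lex.toLex_lt_toLex.2 hlt⟩

theorem keyEntry_eq_of_lexKey_eq {N : ℕ} {x y : Fin N → ℤ} {i j : ℕ}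
    (h : lexKey x i = lexKey y j) (t : Fin N) : keyEntry x i t = keyEntry y j t :=
  congrFun (f := keyEntry x i) (g := keyEntry y j) h t

theorem coordSign_eq_of_min_eq {t i j : ℕ}
    (h : min i (Nat.log 2 (t + 1)) = min j (Nat.log 2 (t + 1))) : coordSign t i = coordSign t j := by
  rcases eq_or_ne i j with rfl | hij
  · rfl
  · have h1 : Nat.log 2 (t + 1) ≤ i := by omega
    have h2 : Nat.log 2 (t + 1) ≤ j := by omega
    simp [coordSign, h1, h2]

/-- Vertices in different blocks at coordinate `t` are ordered by their blocks, as the blocks of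
earlier coordinates are coarser. -/
theorem lexKey_lt_of_block_lt {N : ℕ} {x y : Fin N → ℤ} {t : Fin N} (hxy : ∀ s < t, x s = y s)
    {i j : ℕ} (h : min i (Nat.log 2 (t + 1)) < min j (Nat.log 2 (t + 1))) :
    lexKey x i < lexKey y j := by
  have hij : i < j := by omega
  obtain ⟨s, hs, hmin⟩ := WellFounded.has_min (wellFounded_lt (α := Fin N))
    {s | min i (Nat.log 2 (s + 1)) ≠ min j (Nat.log 2 (s + 1))} ⟨t, h.ne⟩
  have hst : s ≤ t := not_lt.1 (hmin t h.ne)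
  refine lexKey_lt_of_keyEntry s (fun u hu => ?_) ?_
  · have hu' : min i (Nat.log 2 (u + 1)) = min j (Nat.log 2 (u + 1)) :=
      not_not.1 fun h' => hmin u h' hu
    simp [keyEntry, hu', coordSign_eq_of_min_eq hu', hxy u (hu.trans_le hst)]
  · simp only [keyEntry]
    simp only [Set.mem_ofPred_eq] at hs
    left
    omega

theorem lexKey_lt_of_block_eq {N : ℕ} {x y : Fin N → ℤ} {t : Fin N} (hxy : ∀ s < t, x s = y s)
    {i j : ℕ} (h : min i (Nat.log 2 (t + 1)) = min j (Nat.log 2 (t + 1)))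
    (hlt : if coordSign t i then x t < y t else y t < x t) : lexKey x i < lexKey y j := by
  refine lexKey_lt_of_keyEntry t (fun u hu => ?_) ?_
  · have hlog : Nat.log 2 (u + 1) ≤ Nat.log 2 (t + 1) :=
      Nat.log_mono_right (Nat.succ_le_succ (Fin.lt_def.1 hu).le)
    have hu' : min i (Nat.log 2 (u + 1)) = min j (Nat.log 2 (u + 1)) := by omega
    simp [keyEntry, hu', coordSign_eq_of_min_eq hu', hxy u hu]
  · simp only [keyEntry]
    refine Or.inr ⟨h, ?_⟩
    rw [← coordSign_eq_of_min_eq h]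
    split_ifs at hlt ⊢ with hg
    · exact hlt
    · exact neg_lt_neg hlt

/-- The relative order of the vertices of two edges which first differ at coordinate `t`. -/
theorem lexKey_lt_iff {N : ℕ} {x y : Fin N → ℤ} {t : Fin N} (hxy : ∀ s < t, x s = y s)
    (hlt : x t < y t) (i j : ℕ) :
    lexKey x i < lexKey y j ↔ min i (Nat.log 2 (t + 1)) < min j (Nat.log 2 (t + 1)) ∨
      min i (Nat.log 2 (t + 1)) = min j (Nat.log 2 (t + 1)) ∧ coordSign t i = true := by
  have hyx : ∀ s < t, y s = x s := fun s hs => (hxy s hs).symm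
  rcases lt_trichotomy (min i (Nat.log 2 (t + 1))) (min j (Nat.log 2 (t + 1))) with h | h | h
  · simp [h, lexKey_lt_of_block_lt hxy h]
  · by_cases hg : coordSign t i
    · simp [h, hg, lexKey_lt_of_block_eq hxy h (by simp [hg, hlt])]
    · have h' := lexKey_lt_of_block_eq hyx h.symm
        (by rw [← coordSign_eq_of_min_eq h]; simp [hg, hlt])
      simp [h, hg, h'.not_gt]
  · have h' := lexKey_lt_of_block_lt hyx h
    simp [h.not_gt, h.ne', h'.not_gt]

theorem lexKey_ne {N : ℕ} {x y : Fin N → ℤ} {t : Fin N} (hxy : ∀ s < t, x s = y s)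
    (hne : x t ≠ y t) (i j : ℕ) : lexKey x i ≠ lexKey y j := by
  intro h
  have hyx : ∀ s < t, y s = x s := fun s hs => (hxy s hs).symm
  have hb : min i (Nat.log 2 (t + 1)) = min j (Nat.log 2 (t + 1)) := by
    rcases lt_trichotomy (min i (Nat.log 2 (t + 1))) (min j (Nat.log 2 (t + 1))) with h' | h' | h'
    · exact absurd h (lexKey_lt_of_block_lt hxy h').ne
    · exact h'
    · exact absurd h (lexKey_lt_of_block_lt hyx h').ne'
  have hc := keyEntry_eq_of_lexKey_eq h t
  simp only [keyEntry, Prod.mk.injEq, coordSign_eq_of_min_eq hb] at hc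
  refine hne ?_
  split_ifs at hc
  · exact hc.2
  · exact neg_injective hc.2

/-- At the last coordinate, `t + 1 = 2 ^ r - 1`, each of the `r` vertices is a block of its own. -/
theorem lexKey_strictMono {r : ℕ} (hr : 1 ≤ r) (x : Fin (2 ^ r - 1) → ℤ) {i j : ℕ}
    (hij : i < j) (hj : j < r) : lexKey x i < lexKey x j := by
  have h2 : 2 ≤ 2 ^ r := by
    calc 2 = 2 ^ 1 := rfl
      _ ≤ 2 ^ r := Nat.pow_le_pow_right (by norm_num) hr
  have hlog : Nat.log 2 (2 ^ r - 2 + 1) = r - 1 := by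
    rw [show 2 ^ r - 2 + 1 = 2 ^ r - 1 by omega]
    refine (Nat.log_eq_iff (Or.inr ⟨by norm_num, by omega⟩)).2 ⟨?_, ?_⟩
    · obtain ⟨k, rfl⟩ := Nat.exists_eq_add_of_le' hr
      rw [pow_succ] at h2 ⊢
      simp only [Nat.add_sub_cancel]
      omega
    · rw [Nat.sub_add_cancel hr]
      omega
  refine lexKey_lt_of_block_lt (t := ⟨2 ^ r - 2, by omega⟩) (fun _ _ => rfl) ?_
  simp only [hlog]
  omega

theorem eq_of_coordSign_eq {t t' : ℕ}
    (hlog : Nat.log 2 (t + 1) = Nat.log 2 (t' + 1))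
    (hsign : ∀ i < Nat.log 2 (t + 1), coordSign t i = coordSign t' i) : t = t' := by
  have key : t + 1 = t' + 1 := by
    refine Nat.eq_of_testBit_eq fun i => ?_
    rcases lt_trichotomy i (Nat.log 2 (t + 1)) with h | h | h
    · have := hsign i h
      simpa [coordSign, ← hlog, h.not_ge] using this
    · have h1 := Nat.testBit_log2 (n := t + 1) (by omega)
      have h2 := Nat.testBit_log2 (n := t' + 1) (by omega)
      rw [Nat.log2_eq_log_two] at h1 h2
      rw [h, h1, hlog, h2]
    · rw [Nat.testBit_lt_two_pow (Nat.lt_pow_of_log_lt (by norm_num) h),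
        Nat.testBit_lt_two_pow (Nat.lt_pow_of_log_lt (by norm_num) (hlog ▸ h))]
  omega

/-- The relative order of the vertices of two edges determines the coordinate at which they first
differ. -/
theorem eq_of_lexKey_cross_order {r : ℕ} (hr : 1 ≤ r) {x y x' y' : Fin (2 ^ r - 1) → ℤ}
    {t t' : Fin (2 ^ r - 1)}
    (hxy : ∀ s < t, x s = y s) (hne : x t ≠ y t)
    (hxy' : ∀ s < t', x' s = y' s) (hne' : x' t' ≠ y' t')
    (h : ∀ i < r, ∀ j < r, lexKey x i < lexKey y j ↔ lexKey x' i < lexKey y' j) : t = t' := by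
  have hlog : ∀ t : Fin (2 ^ r - 1), Nat.log 2 (t + 1) < r := fun t =>
    Nat.log_lt_of_lt_pow (by omega) (by have := t.2; omega)
  have hlt : ∀ {x y x' y' : Fin (2 ^ r - 1) → ℤ}, (∀ s < t, x s = y s) → x t < y t →
      (∀ s < t', x' s = y' s) → x' t' ≠ y' t' →
      (∀ i < r, ∀ j < r, lexKey x i < lexKey y j ↔ lexKey x' i < lexKey y' j) → t = t' := by
    intro x y x' y' hxy hlt hxy' hne' h
    have hL := hlog t
    have hL' := hlog t'
    -- The comparison of the last vertices tells which edge is larger at coordinate `t`.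
    have hlast : lexKey x (r - 1) < lexKey y (r - 1) := by
      rw [lexKey_lt_iff hxy hlt]
      have : Nat.log 2 (t + 1) ≤ r - 1 := by omega
      simp [coordSign, this]
    have hlt' : x' t' < y' t' := by
      refine lt_of_le_of_ne (not_lt.1 fun hgt => ?_) hne'
      have h1 := (h (r - 1) (by omega) (r - 1) (by omega)).1 hlast
      have h2 : lexKey y' (r - 1) < lexKey x' (r - 1) := by
        rw [lexKey_lt_iff (fun s hs => (hxy' s hs).symm) hgt]
        have : Nat.log 2 (t' + 1) ≤ r - 1 := by omega
        simp [coordSign, this]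
      exact lt_asymm h1 h2
    simp only [lexKey_lt_iff hxy hlt, lexKey_lt_iff hxy' hlt'] at h
    -- The blocks are recovered by comparing the last vertex of `x` with all vertices of `y`.
    have hle : ∀ i < r, (Nat.log 2 (t + 1) ≤ i ↔ Nat.log 2 (t' + 1) ≤ i) := by
      intro i hi
      have hs : ∀ t : Fin (2 ^ r - 1), coordSign t (r - 1) = true := by
        intro t
        have : Nat.log 2 (t + 1) ≤ r - 1 := by have := hlog t; omega
        simp [coordSign, this]
      have := h (r - 1) (by omega) i hi
      simp only [hs, and_true] at this
      omega
    have hlogeq : Nat.log 2 (t + 1) = Nat.log 2 (t' + 1) :=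
      le_antisymm ((hle _ hL').2 le_rfl) ((hle _ hL).1 le_rfl)
    refine Fin.ext (eq_of_coordSign_eq hlogeq fun i hi => ?_)
    have := h i (by omega) i (by omega)
    rw [Bool.eq_iff_iff]
    simpa only [lt_irrefl, true_and, false_or] using this
  rcases lt_or_gt_of_ne hne with hl | hg
  · exact hlt hxy hl hxy' hne' h
  · refine hlt (x' := y') (y' := x') (fun s hs => (hxy s hs).symm) hg
      (fun s hs => (hxy' s hs).symm) hne'.symm fun i hi j hj => ?_
    have h1 := h j hj i hi
    rw [← not_iff_not, not_lt, not_lt] at h1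
    rw [lt_iff_le_and_ne, lt_iff_le_and_ne, h1]
    simp [(lexKey_ne hxy hne j i).symm, (lexKey_ne hxy' hne' j i).symm]

/-! ### A matching with small clique number -/

/-- The ordered matching whose edges are the ranges of `n` order embeddings of `Fin r` with disjoint
ranges. Its vertex set is the union of these ranges. -/
noncomputable def OrderedMatching.ofEmbeddings {r n : ℕ} {κ : Type*} [LinearOrder κ]
    (v : Fin n → Fin r ↪o κ) (hv : ∀ a b i j, v a i = v b j → a = b) :
    OrderedMatching r {z : κ // ∃ a i, v a i = z} where
  edges := Finset.univ.image fun a => Finset.univ.map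
    (OrderEmbedding.ofStrictMono (fun i => (⟨v a i, a, i, rfl⟩ : {z : κ // ∃ a i, v a i = z}))
      fun _ _ h => (v a).strictMono h).toEmbedding
  card_edge := by
    intro e he
    obtain ⟨a, -, rfl⟩ := Finset.mem_image.1 he
    simp
  existsUnique_edge := by
    rintro ⟨_, a, i, rfl⟩
    refine ⟨_, ⟨Finset.mem_image_of_mem _ (Finset.mem_univ a), ?_⟩, ?_⟩
    · exact Finset.mem_map.2 ⟨i, Finset.mem_univ i, rfl⟩
    · rintro e ⟨he, hx⟩
      obtain ⟨b, -, rfl⟩ := Finset.mem_image.1 he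
      obtain ⟨j, -, hj⟩ := Finset.mem_map.1 hx
      have := hv b a j i (congrArg Subtype.val hj)
      subst this
      rfl

theorem exists_matching_cliqueNumber_le {r n k : ℕ} (hr : 1 ≤ r)
    (hn : n ≤ k ^ (2 ^ r - 1)) :
    ∃ (V : Type) (_ : LinearOrder V) (M : OrderedMatching r V),
      M.size = n ∧ M.cliqueNumber ≤ k := by
  classical
  have hcard : Fintype.card (Fin n) ≤ Fintype.card (Fin (2 ^ r - 1) → Fin k) := by simpa using hn
  obtain ⟨f⟩ := Function.Embedding.nonempty_of_card_le hcard
  let x : Fin n → Fin (2 ^ r - 1) → ℤ := fun a t => ((f a t : ℕ) : ℤ)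
  have hx : ∀ a b t, x a t = x b t ↔ f a t = f b t := by
    intro a b t
    simp [x, Fin.ext_iff]
  have hdiff : ∀ a b, a ≠ b → ∃ t, (∀ s < t, x a s = x b s) ∧ x a t ≠ x b t := by
    intro a b hab
    obtain ⟨t, ht⟩ : ∃ t, x a t ≠ x b t := by
      by_contra hcon
      push Not at hcon
      exact hab (f.injective (funext fun t => (hx a b t).1 (hcon t)))
    obtain ⟨s, hs, hmin⟩ := WellFounded.has_min (wellFounded_lt (α := Fin (2 ^ r - 1)))
      {t | x a t ≠ x b t} ⟨t, ht⟩
    exact ⟨s, fun u hu => not_not.1 fun h => hmin u h hu, hs⟩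
  let v : Fin n → Fin r ↪o KeySpace (2 ^ r - 1) := fun a =>
    OrderEmbedding.ofStrictMono (fun i => lexKey (x a) i)
      fun i j hij => lexKey_strictMono hr (x a) hij j.2
  have hv : ∀ a b i j, v a i = v b j → a = b := by
    intro a b i j h
    by_contra hab
    obtain ⟨t, h1, h2⟩ := hdiff a b hab
    exact lexKey_ne h1 h2 i j h
  let M := OrderedMatching.ofEmbeddings v hv
  let u : Fin n → Fin r ↪o {z : KeySpace (2 ^ r - 1) // ∃ a i, v a i = z} := fun a =>
    OrderEmbedding.ofStrictMono (fun i => ⟨v a i, a, i, rfl⟩) fun _ _ h => (v a).strictMono h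
  have hu : ∀ a b i j, u a i < u b j ↔ lexKey (x a) i < lexKey (x b) j := fun _ _ _ _ => Iff.rfl
  let E : Fin n → Finset {z : KeySpace (2 ^ r - 1) // ∃ a i, v a i = z} := fun a =>
    Finset.univ.map (u a).toEmbedding
  have hedges : M.edges = Finset.univ.image E := rfl
  have hE : Function.Injective E := by
    intro a b hab
    have h1 : u a ⟨0, hr⟩ ∈ E a := Finset.mem_map_of_mem _ (Finset.mem_univ _)
    rw [hab] at h1
    obtain ⟨j, -, hj⟩ := Finset.mem_map.1 h1
    exact (hv b a j ⟨0, hr⟩ (congrArg Subtype.val hj)).symm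
  have hsize : M.size = n := by
    rw [OrderedMatching.size, hedges, Finset.card_image_of_injective _ hE, Finset.card_fin]
  refine ⟨_, inferInstance, M, hsize, ?_⟩
  refine Finset.sup_le fun P _ => Finset.sup_le fun S hS => ?_
  rw [Finset.mem_filter, Finset.mem_powerset] at hS
  obtain ⟨hSM, hP⟩ := hS
  let A : Finset (Fin n) := Finset.univ.filter fun a => E a ∈ S
  have hAS : S = A.image E := by
    ext e
    constructor
    · intro he
      have := hSM he
      rw [hedges] at this
      obtain ⟨a, -, rfl⟩ := Finset.mem_image.1 this
      exact Finset.mem_image_of_mem _ (by simp [A, he])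
    · intro he
      obtain ⟨a, ha, rfl⟩ := Finset.mem_image.1 he
      simpa [A] using ha
  rw [hAS, Finset.card_image_of_injective _ hE]
  have hAP : ∀ a ∈ A, ∀ b ∈ A, a ≠ b → FormsPattern P (E a) (E b) := fun a ha b hb hab =>
    hP _ (by simpa [A] using ha) _ (by simpa [A] using hb) (hE.ne hab)
  -- All pairs of members of `A` first differ at the same `t`, so `a ↦ f a t` is injective on `A`.
  by_cases hsub : ∀ a ∈ A, ∀ b ∈ A, a = b
  · rcases A.eq_empty_or_nonempty with h0 | ⟨a₀, -⟩
    · simp [h0]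
    · have h2 : 2 ^ 1 ≤ 2 ^ r := Nat.pow_le_pow_right (by norm_num) hr
      have hk : 0 < k := (f a₀ ⟨0, by omega⟩).pos
      exact (Finset.card_le_one.2 hsub).trans hk
  · push Not at hsub
    obtain ⟨a, ha, b, hb, hab⟩ := hsub
    obtain ⟨t, ht, htne⟩ := hdiff a b hab
    have hg : Set.InjOn (fun c => f c t) A := by
      intro c hc d hd hcd
      by_contra hne
      obtain ⟨t', ht', htne'⟩ := hdiff c d hne
      have htt : t = t' := by
        rcases (hAP a ha b hb hab).lt_iff_lt_or (hAP c hc d hd hne) with h | h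
        · exact eq_of_lexKey_cross_order hr ht htne ht' htne' fun i hi j hj =>
            h ⟨i, hi⟩ ⟨j, hj⟩
        · exact eq_of_lexKey_cross_order hr ht htne (fun s hs => (ht' s hs).symm) htne'.symm
            fun i hi j hj => h ⟨i, hi⟩ ⟨j, hj⟩
      subst htt
      exact htne' ((hx c d t).2 hcd)
    simpa using Finset.card_le_card_of_injOn _ (t := Finset.univ)
      (fun _ _ => Finset.mem_univ _) hg

/-! ### Bounds on the Ramsey parameter -/

theorem theorem1p1 (r n : ℕ) (hr : 2 ≤ r) :
    1 / ((r : ℝ) - 1) * (n : ℝ) ^ (1 / (((r : ℝ) + 1) * (2 : ℝ) ^ (r - 2)))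
        ≤ (ramseyParameter r n : ℝ) ∧
      ramseyParameter r n ≤ ⌈(n : ℝ) ^ (1 / ((2 : ℝ) ^ r - 1))⌉₊ := by
  constructor
  · obtain ⟨m, rfl⟩ := Nat.exists_eq_add_of_le' (show 1 ≤ r by omega)
    have hm : 1 ≤ m := by omega
    obtain ⟨V, _, M, hM, hL⟩ := exists_cliqueNumber_eq_ramseyParameter (m + 1) n (by omega)
    have h := M.size_le_pow hm
    rw [hM, hL] at h
    have hexp : (((m + 1 : ℕ) : ℝ) + 1) * (2 : ℝ) ^ (m + 1 - 2) =
        (((m + 2) * 2 ^ (m - 1) : ℕ) : ℝ) := by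
      rw [show m + 1 - 2 = m - 1 by omega]
      push_cast
      ring
    have hE : (m + 2) * 2 ^ (m - 1) ≠ 0 := by positivity
    have hm' : (0 : ℝ) < m := by exact_mod_cast hm
    rw [hexp, show ((m + 1 : ℕ) : ℝ) - 1 = m by push_cast; ring, one_div_mul_eq_div,
      div_le_iff₀' hm', one_div]
    have h' : (n : ℝ) ≤ ((m : ℝ) * ramseyParameter (m + 1) n) ^ ((m + 2) * 2 ^ (m - 1)) := by
      exact_mod_cast h
    calc (n : ℝ) ^ ((((m + 2) * 2 ^ (m - 1) : ℕ) : ℝ)⁻¹)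
        ≤ (((m : ℝ) * ramseyParameter (m + 1) n) ^ ((m + 2) * 2 ^ (m - 1))) ^
            ((((m + 2) * 2 ^ (m - 1) : ℕ) : ℝ)⁻¹) :=
          Real.rpow_le_rpow (by positivity) h' (by positivity)
      _ = _ := Real.pow_rpow_inv_natCast (by positivity) hE
  · have h2 : 2 ≤ 2 ^ r := by
      calc 2 = 2 ^ 1 := rfl
        _ ≤ 2 ^ r := Nat.pow_le_pow_right (by norm_num) (by omega)
    have hcast : (2 : ℝ) ^ r - 1 = ((2 ^ r - 1 : ℕ) : ℝ) := by
      rw [Nat.cast_sub (by omega)]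
      push_cast
      ring
    rw [hcast, one_div]
    have hn : n ≤ ⌈(n : ℝ) ^ ((((2 ^ r - 1 : ℕ) : ℝ))⁻¹)⌉₊ ^ (2 ^ r - 1) := by
      have h1 : (n : ℝ) = ((n : ℝ) ^ ((((2 ^ r - 1 : ℕ) : ℝ))⁻¹)) ^ (2 ^ r - 1) :=
        (Real.rpow_inv_natCast_pow (Nat.cast_nonneg n) (by omega)).symm
      have h3 : (n : ℝ) ≤ ((⌈(n : ℝ) ^ ((((2 ^ r - 1 : ℕ) : ℝ))⁻¹)⌉₊ : ℕ) : ℝ) ^ (2 ^ r - 1) := by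
        conv_lhs => rw [h1]
        exact pow_le_pow_left₀ (by positivity) (Nat.le_ceil _) _
      exact_mod_cast h3
    obtain ⟨V, hV, M, hM, hL⟩ := exists_matching_cliqueNumber_le (by omega) hn
    exact le_trans (Nat.sInf_le (show M.cliqueNumber ∈ {k : ℕ | ∃ (V : Type) (_ : LinearOrder V)
      (M : OrderedMatching r V), M.size = n ∧ M.cliqueNumber = k} from ⟨V, hV, M, hM, rfl⟩)) hL
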